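/- Let $\Sigma$ be a finite nonempty alphabet and $\mathcal A=(Q,\delta,I,Q_F\cup\delta_F)$ a B\"uchi automaton with finite state set $Q$, $n=|Q|$, transition function $\delta\colon Q\times\Sigma\to 2^Q$, initial states $I\subseteq Q$, accepting states $Q_F\subseteq Q$ and accepting transitions $\delta_F\subseteq\delta$. A run is accepting iff some state of $Q_F$ or some transition of $\delta_F$ occurs in it infinitely often; $\mathcal L(\mathcal A)\subseteq\Sigma^\omega$ is the set of words with an accepting run starting in $I$. Write $\delta(S,a)=\bigcup_{q\in S}\delta(q,a)$. **Run DAG and ranks.** For $\alpha=\alpha_0\alpha_1\dots\in\Sigma^\omega$ let $\mathrm{level}_\alpha(0)=I$ and $\mathrm{level}_\alpha(k+1)=\delta(\mathrm{level}_\alpha(k),\alpha_k)$. The run DAG $\mathcal G_\alpha$ has the vertices $(q,k)$ with $q\in\mathrm{level}_\alpha(k)$ and the edges $(q,k)\to(q',k+1)$ with $q'\in\delta(q,\alpha_k)$. A vertex $(q,k)$ is accepting if $q\in Q_F$; an edge is accepting if the corresponding transition is in $\delta_F$. A vertex of a subgraph is finite if it reaches only finitely many vertices in it, and endangered if it reaches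 (in zero or more steps) no accepting vertex and no accepting edge in it. Put $\mathcal G^0=\mathcal G_\alpha$; for $0\le j\le 2n$ obtain $\mathcal G^{j+1}$ from $\mathcal G^j$ by removing all finite vertices if $j$ is even, and all endangered vertices if $j$ is odd; the vertices removed in step $j$ get rank $j$, and the vertices never removed get rank $\omega$. Let $f^\alpha_k(q)$ be the rank of $(q,k)$ if $q\in\mathrm{level}_\alpha(k)$, and $0$ otherwise. **Rankings.** A ranking is a function $f\colon Q\to\{0,\dots,2n\}$ with even values on $Q_F$; its rank is $\mathrm{rank}(f)=\max_q f(q)$; $f\le g$ is meant pointwise. For $S\subseteq Q$, $f$ is $S$-tight if $r=\mathrm{rank}(f)$ is odd, $\{1,3,\dots,r\}\subseteq f(S)$ and $f(q)=0$ for all $q\notin S$; $f$ is tight if it is $Q$-tight. Write $f\rhd_S^a f'$ if for all $q\in S$: $f'(q')\le f(q)$ for all $q'\in\delta(q,a)$, and $f'(q'')\le 2\lfloor f(q)/2\rfloor$ for all $q''\in\delta_F(q,a)$. **TRUBs.** Level $\ell$ is tight in $\mathcal G_\alpha$ if for all $k\ge\ell$ the function $f^\alpha_k$ is a tight ranking and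 $\mathrm{rank}(f^\alpha_k)=\mathrm{rank}(f^\alpha_\ell)$. A map $\mu$ assigning to each $S\subseteq Q$ a function $\mu(S)\colon Q\to\mathbb N$ (for example a ranking) is a tight rank upper bound (TRUB) if for every $\alpha\notin\mathcal L(\mathcal A)$ on which $\mathcal A$ has at least one (infinite) run from $I$ there is an $\ell$ such that level $\ell$ is tight in $\mathcal G_\alpha$ and $f^\alpha_k\le\mu(\mathrm{level}_\alpha(k))$ for all $k\ge\ell$. A map $\mu'\colon 2^Q\to\mathbb N$ is called a TRUB if $\mathrm{inf}(\mu')$ is one, where $\mathrm{inf}(\mu')(S)(q)=\max(\mu'(S)-1,0)$ for $q\in Q_F$ and $\mathrm{inf}(\mu')(S)(q)=\mu'(S)$ for $q\notin Q_F$; such a $\mu'$ is then identified with $\mathrm{inf}(\mu')$. **Schewe's construction.** $\mathrm{Schewe}(\mathcal A)$ is the state-based B\"uchi automaton over $\Sigma$ with state set $Q_1\cup Q_2$, where $Q_1=2^Q$ (waiting part) and $Q_2$ (tight part) is the set of all $(S,O,f,i)$ with $S,O\subseteq Q$, $f$ an $S$-tight ranking, $i\in\{0,2,\dots,2n-2\}$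 and $O\subseteq S\cap f^{-1}(i)$. Its only initial state is $I\in Q_1$. On a letter $a$, a state $S\in Q_1$ has as successors $\delta(S,a)\in Q_1$ and all $(\delta(S,a),\emptyset,f,0)\in Q_2$. A state $(S,O,f,i)\in Q_2$ has as successors all $(S',O',f',i')\in Q_2$ with $S'=\delta(S,a)$, $f\rhd_S^a f'$, $\mathrm{rank}(f)=\mathrm{rank}(f')$ and: if $O=\emptyset$, then $i'=(i+2)\bmod(\mathrm{rank}(f')+1)$ and $O'=S'\cap f'^{-1}(i')$; if $O\ne\emptyset$, then $i'=i$ and $O'=\delta(O,a)\cap f'^{-1}(i)$. The accepting states are $\emptyset\in Q_1$ and all $(S,\emptyset,f,i)\in Q_2$. **Lemma.** Let $\mu$ be a TRUB (function-valued, or number-valued and identified with $\mathrm{inf}(\mu)$), and let $\mathcal B$ be the B\"uchi automaton obtained from $\mathrm{Schewe}(\mathcal A)$ by replacing all occurrences of $Q_2$ by $Q_2'=\{(S,O,f,i)\in Q_2\mid f\le\mu(S)\}$. Then $\mathcal L(\mathcal B)=\Sigma^\omega\setminus\mathcal L(\mathcal A)$. -/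

import Mathlib

open Filter

/-- A (nondeterministic, transition/state-based) Büchi automaton over the alphabet `σ` with state
type `Q`: `F` is the set of accepting states, `δF` the set of accepting transitions. Finiteness of
`Q` and `σ` is imposed by instance arguments where it is needed. -/
structure BA (σ Q : Type*) where
  δ : Q → σ → Set Q
  I : Set Q
  F : Set Q
  δF : Q → σ → Set Q
  δF_subset : ∀ q a, δF q a ⊆ δ q a

namespace BA

section Basic

variable {σ Q : Type*} (A : BA σ Q)

/-- The transition function extended to sets of states. -/
def post (S : Set Q) (a : σ) : Set Q := {q' | ∃ q ∈ S, q' ∈ A.δ q a}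

/-- `ρ` is an (infinite) run on `w` starting in an initial state. -/
def IsRun (w : ℕ → σ) (ρ : ℕ → Q) : Prop :=
  ρ 0 ∈ A.I ∧ ∀ k, ρ (k + 1) ∈ A.δ (ρ k) (w k)

/-- Some accepting state, or some accepting transition, occurs infinitely often. -/
def IsAccepting (w : ℕ → σ) (ρ : ℕ → Q) : Prop :=
  (∃ q ∈ A.F, ∃ᶠ k in atTop, ρ k = q) ∨
  (∃ p a q, q ∈ A.δF p a ∧ ∃ᶠ k in atTop, ρ k = p ∧ w k = a ∧ ρ (k + 1) = q)

/-- The language of the automaton. -/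
def language : Set (ℕ → σ) := {w | ∃ ρ, A.IsRun w ρ ∧ A.IsAccepting w ρ}

/-! Run DAGs and ranks of their vertices. -/

/-- The `k`-th level of the run DAG over `w`: the states reachable from an initial state by
reading the first `k` letters of `w`. -/
def level (w : ℕ → σ) : ℕ → Set Q
  | 0 => A.I
  | k + 1 => A.post (level w k) (w k)

/-- The vertices of the run DAG over `w`. -/
def dag (w : ℕ → σ) : Set (Q × ℕ) := {v | v.1 ∈ A.level w v.2}

/-- The edges of the subgraph of the run DAG induced by the set of vertices `G`. -/
def Edge (w : ℕ → σ) (G : Set (Q × ℕ)) (u v : Q × ℕ) : Prop :=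
  u ∈ G ∧ v ∈ G ∧ v.2 = u.2 + 1 ∧ v.1 ∈ A.δ u.1 (w u.2)

/-- Reachability in the subgraph induced by `G` (every vertex reaches itself). -/
def Reach (w : ℕ → σ) (G : Set (Q × ℕ)) : Q × ℕ → Q × ℕ → Prop :=
  Relation.ReflTransGen (A.Edge w G)

/-- The finite vertices of `G`. -/
def finiteVertices (w : ℕ → σ) (G : Set (Q × ℕ)) : Set (Q × ℕ) :=
  {v | v ∈ G ∧ {u | A.Reach w G v u}.Finite}

/-- The endangered vertices of `G`: they reach neither an accepting vertex nor an accepting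
edge of `G`. -/
def endangeredVertices (w : ℕ → σ) (G : Set (Q × ℕ)) : Set (Q × ℕ) :=
  {v | v ∈ G ∧ ∀ u, A.Reach w G v u →
    u.1 ∉ A.F ∧ ∀ u', A.Edge w G u u' → u'.1 ∉ A.δF u.1 (w u.2)}

/-- The sequence of DAGs of the ranking procedure: step `j` removes the finite vertices if `j` is
even, and the endangered vertices if `j` is odd. -/
def dagSeq (w : ℕ → σ) : ℕ → Set (Q × ℕ)
  | 0 => A.dag w
  | j + 1 =>
    {v | v ∈ dagSeq w j ∧
      (Even j → v ∉ A.finiteVertices w (dagSeq w j)) ∧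
      (Odd j → v ∉ A.endangeredVertices w (dagSeq w j))}

variable [Fintype Q]

/-- The rank of a vertex `v` of the run DAG: the step `j` among the `2 * |Q| + 1` steps
`0, …, 2 * |Q|` in which `v` is removed, and `⊤` (that is, `ω`) if `v` is never removed. -/
noncomputable def vertexRank (w : ℕ → σ) (v : Q × ℕ) : ℕ∞ :=
  ⨅ j ∈ {j : ℕ | j ≤ 2 * Fintype.card Q ∧ v ∉ A.dagSeq w (j + 1)}, (j : ℕ∞)

open Classical in
/-- The ranking of the `k`-th level of the run DAG. -/
noncomputable def levelRanking (w : ℕ → σ) (k : ℕ) (q : Q) : ℕ∞ :=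
  if q ∈ A.level w k then A.vertexRank w (q, k) else 0

/-! Rankings. -/

/-- `f` is a (level) ranking. -/
def IsRanking (f : Q → ℕ) : Prop :=
  (∀ q, f q ≤ 2 * Fintype.card Q) ∧ ∀ q ∈ A.F, Even (f q)

/-- The rank of a ranking. -/
def rankOf (f : Q → ℕ) : ℕ := Finset.univ.sup f

/-- `f` is an `S`-tight ranking. -/
def IsTight (S : Set Q) (f : Q → ℕ) : Prop :=
  A.IsRanking f ∧ Odd (rankOf f) ∧
  (∀ m, Odd m → m ≤ rankOf f → ∃ q ∈ S, f q = m) ∧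
  ∀ q, q ∉ S → f q = 0

/-- The transition consistency relation between rankings; `2 * (m / 2)` is the largest even
number that is at most `m`. -/
def Consistent (S : Set Q) (a : σ) (f f' : Q → ℕ) : Prop :=
  ∀ q ∈ S, (∀ q' ∈ A.δ q a, f' q' ≤ f q) ∧ ∀ q' ∈ A.δF q a, f' q' ≤ 2 * (f q / 2)

/-! Tight rank upper bounds. -/

/-- The `l`-th level of the run DAG over `w` is tight: from `l` on, all level rankings are tight
rankings (of `Q`) of the same rank. -/
def LevelTight (w : ℕ → σ) (l : ℕ) : Prop :=
  ∃ r : ℕ, ∀ k ≥ l, ∃ f : Q → ℕ,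
    (∀ q, (f q : ℕ∞) = A.levelRanking w k q) ∧ A.IsTight Set.univ f ∧ rankOf f = r

/-- `μ` is a tight rank upper bound with respect to the word `w`. -/
def IsTRUBWrt (μ : Set Q → Q → ℕ) (w : ℕ → σ) : Prop :=
  ∃ l, A.LevelTight w l ∧ ∀ k ≥ l, ∀ q, A.levelRanking w k q ≤ (μ (A.level w k) q : ℕ∞)

/-- `μ` is a tight rank upper bound: it is one with respect to every word outside the language
on which the automaton has a run. (The levels of a run DAG without an infinite path are
eventually empty, hence never tight.) The values of `μ` may be any functions `Q → ℕ`, in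
particular rankings. -/
def IsTRUB (μ : Set Q → Q → ℕ) : Prop :=
  ∀ w, w ∉ A.language → (∃ ρ, A.IsRun w ρ) → A.IsTRUBWrt μ w

open Classical in
/-- The function-valued map associated with a number-valued map: accepting states get the
value minus one (truncated at zero). -/
noncomputable def infunc (μ : Set Q → ℕ) : Set Q → Q → ℕ :=
  fun S q => if q ∈ A.F then μ S - 1 else μ S

end Basic

/-! Schewe's construction. -/

/-- Quadruples `(S, O, f, i)`. -/
@[ext] structure Macrostate (Q : Type*) where
  S : Set Q
  O : Set Q
  f : Q → ℕ
  i : ℕ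

section Schewe

variable {σ Q : Type*} [Fintype Q] (A : BA σ Q)

/-- The macrostates of the tight part; an `S`-tight ranking is in particular tight. The bound on
`i` says `i ∈ {0, 2, …, 2 * |Q| - 2}`. -/
def tightPart : Set (Macrostate Q) :=
  {m | A.IsTight m.S m.f ∧ m.O ⊆ m.S ∩ {q | m.f q = m.i} ∧
    Even m.i ∧ m.i + 2 ≤ 2 * Fintype.card Q}

/-- The successors of a waiting macrostate in the tight part. -/
def EntersTight (S : Set Q) (a : σ) (m : Macrostate Q) : Prop :=
  m.S = A.post S a ∧ m.O = ∅ ∧ A.IsTight m.S m.f ∧ m.i = 0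

/-- The transitions inside the tight part. -/
def TightStep (m : Macrostate Q) (a : σ) (m' : Macrostate Q) : Prop :=
  m'.S = A.post m.S a ∧ A.Consistent m.S a m.f m'.f ∧ rankOf m.f = rankOf m'.f ∧
  (m.O = ∅ → m'.i = (m.i + 2) % (rankOf m'.f + 1) ∧ m'.O = m'.S ∩ {q | m'.f q = m'.i}) ∧
  (m.O ≠ ∅ → m'.i = m.i ∧ m'.O = A.post m.O a ∩ {q | m'.f q = m.i})

/-- Schewe's construction where the macrostates of the tight part are taken from the set `T`.
The states `Sum.inl S` form the waiting part. -/
def scheweWith (T : Set (Macrostate Q)) : BA σ (Set Q ⊕ T) where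
  δ := fun p a =>
    match p with
    | Sum.inl S =>
      {Sum.inl (A.post S a)} ∪ {p' | ∃ m : T, A.EntersTight S a m.1 ∧ p' = Sum.inr m}
    | Sum.inr m => {p' | ∃ m' : T, A.TightStep m.1 a m'.1 ∧ p' = Sum.inr m'}
  I := {Sum.inl A.I}
  F := {Sum.inl ∅} ∪ {p | ∃ m : T, m.1.O = ∅ ∧ p = Sum.inr m}
  δF := fun _ _ => ∅
  δF_subset := fun _ _ => Set.empty_subset _

/-- Schewe's complement automaton. -/
def schewe : BA σ (Set Q ⊕ A.tightPart) := A.scheweWith A.tightPart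

/-- The macrostates of the tight part whose ranking is covered by `μ`. -/
def reducedTightPart (μ : Set Q → Q → ℕ) : Set (Macrostate Q) :=
  {m | m ∈ A.tightPart ∧ m.f ≤ μ m.S}

/-- Schewe's complement automaton with the tight part restricted by `μ`. -/
def reducedSchewe (μ : Set Q → Q → ℕ) : BA σ (Set Q ⊕ A.reducedTightPart μ) :=
  A.scheweWith (A.reducedTightPart μ)

/-- The tight part is finite, so that the automata above have finitely many states. -/
theorem tightPart_finite : A.tightPart.Finite := by
  classical
  let g : Macrostate Q → Set Q × Set Q × (Q → ℕ) × ℕ := fun m => (m.S, m.O, m.f, m.i)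
  have hg : Function.Injective g := by
    intro m m' h
    simp only [g, Prod.mk.injEq] at h
    exact Macrostate.ext h.1 h.2.1 h.2.2.1 h.2.2.2
  have hfin : ((Set.univ : Set (Set Q)) ×ˢ (Set.univ : Set (Set Q)) ×ˢ
      (Set.univ.pi fun _ : Q => Set.Iic (2 * Fintype.card Q)) ×ˢ
      Set.Iic (2 * Fintype.card Q)).Finite :=
    Set.finite_univ.prod (Set.finite_univ.prod
      ((Set.Finite.pi fun _ => Set.finite_Iic _).prod (Set.finite_Iic _)))
  refine (hfin.preimage hg.injOn).subset ?_
  rintro m ⟨⟨⟨h, -⟩, -⟩, -, -, hi⟩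
  refine ⟨trivial, trivial, fun q _ => h q, ?_⟩
  change m.i ≤ _
  omega

instance : Finite A.tightPart := A.tightPart_finite

instance (μ : Set Q → Q → ℕ) : Finite (A.reducedTightPart μ) :=
  A.tightPart_finite.subset fun _ h => h.1

end Schewe

end BA

namespace BA

/-! ### Run DAGs, König's lemma, and consistency of the DAG's own ranks. -/

section RunDag

variable {σ Q : Type*} (A : BA σ Q)

/-! Soundness holds for any restriction of the tight part. Suppose a word carries both an accepting
run of `A` and an accepting run of macrostates. Its levels are never empty, so the macrostates must
end up in the tight part. Along the run of `A` ranks do not increase there, so they stabilise, and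
acceptance forces the limit to be even. The index `i` cycles through all even numbers below the
rank, so it meets this limit at some breakpoint; the run is then trapped in `O`, which never empties
again (`scheweWith_language_subset`).

For completeness, a word without runs has an empty level by König's lemma and is accepted in the
waiting part. For any other rejected word, the TRUB supplies a level from which the DAG's own
rankings are tight, of constant rank and below `μ`; the macrostate run guesses exactly these. Its
set `O` tracks vertices of one even rank `i`, which reach only finitely many vertices of the `i`-th
DAG, so `O` empties infinitely often (`breakpointRun_frequently_empty`). The number-valued case is
an instance of the function-valued one. -/

theorem IsRun.mem_level {A : BA σ Q} {w : ℕ → σ} {ρ : ℕ → Q} (h : A.IsRun w ρ) (k : ℕ) :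
    ρ k ∈ A.level w k := by
  induction k with
  | zero => exact h.1
  | succ k ih => exact ⟨ρ k, ih, h.2 k⟩

theorem exists_prefix_of_mem_level (w : ℕ → σ) (m : ℕ) :
    ∀ q ∈ A.level w m, ∃ ρ : ℕ → Q,
      ρ 0 ∈ A.I ∧ (∀ k < m, ρ (k + 1) ∈ A.δ (ρ k) (w k)) ∧ ρ m = q := by
  induction m with
  | zero => exact fun q hq => ⟨fun _ => q, hq, by simp, rfl⟩
  | succ m ih =>
    rintro q ⟨p, hp, hq⟩
    obtain ⟨ρ, h0, hρ, rfl⟩ := ih p hp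
    refine ⟨Function.update ρ (m + 1) q, ?_, fun k hk => ?_, by simp⟩
    · rwa [Function.update_of_ne (by omega)]
    · rw [Function.update_of_ne (show k ≠ m + 1 by omega)]
      rcases Nat.lt_succ_iff_lt_or_eq.1 hk with hk | rfl
      · rw [Function.update_of_ne (by omega)]
        exact hρ k hk
      · simpa using hq

/-- König's lemma for the run DAG. -/
theorem exists_isRun_of_level_nonempty [Finite Q] (w : ℕ → σ)
    (h : ∀ k, (A.level w k).Nonempty) : ∃ ρ, A.IsRun w ρ := by
  let _ : TopologicalSpace Q := ⊥
  have : DiscreteTopology Q := ⟨rfl⟩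
  -- Sequences that are runs up to step `m` form nested closed nonempty sets in the compact space `ℕ
  -- → Q`; a common point is a run.
  let C : ℕ → Set (ℕ → Q) := fun m =>
    {ρ | ρ 0 ∈ A.I} ∩ ⋂ k ∈ Set.Iio m, {ρ | ρ (k + 1) ∈ A.δ (ρ k) (w k)}
  have hC : ∀ m, IsClosed (C m) := by
    intro m
    refine ((isClosed_discrete A.I).preimage (continuous_apply 0)).inter
      (isClosed_biInter fun k _ => ?_)
    have hcont : Continuous fun ρ : ℕ → Q => (ρ k, ρ (k + 1)) := by fun_prop
    exact (isClosed_discrete {p : Q × Q | p.2 ∈ A.δ p.1 (w k)}).preimage hcont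
  have hne : (⋂ m, C m).Nonempty := by
    refine IsCompact.nonempty_iInter_of_sequence_nonempty_isCompact_isClosed C ?_ ?_
      (hC 0).isCompact hC
    · rintro m ρ ⟨h0, hρ⟩
      simp only [Set.mem_iInter, Set.mem_Iio] at hρ
      refine ⟨h0, ?_⟩
      simp only [Set.mem_iInter, Set.mem_Iio]
      exact fun k hk => hρ k (by omega)
    · intro m
      obtain ⟨q, hq⟩ := h m
      obtain ⟨ρ, h0, hρ, -⟩ := A.exists_prefix_of_mem_level w m q hq
      refine ⟨ρ, h0, ?_⟩
      simpa only [Set.mem_iInter, Set.mem_Iio, Set.mem_ofPred_eq] using hρ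
  obtain ⟨ρ, hρ⟩ := hne
  rw [Set.mem_iInter] at hρ
  refine ⟨ρ, (hρ 0).1, fun k => ?_⟩
  have := (hρ (k + 1)).2
  simp only [Set.mem_iInter, Set.mem_Iio] at this
  exact this k (Nat.lt_succ_self k)

theorem post_empty (a : σ) : A.post ∅ a = ∅ := by
  simp [post]

theorem level_eq_empty_of_le {w : ℕ → σ} {k m : ℕ} (h : A.level w k = ∅) (hkm : k ≤ m) :
    A.level w m = ∅ := by
  induction m, hkm using Nat.le_induction with
  | base => exact h
  | succ m _ ih =>
    change A.post (A.level w m) (w m) = ∅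
    rw [ih, post_empty]

theorem dagSeq_antitone (w : ℕ → σ) : Antitone (A.dagSeq w) :=
  antitone_nat_of_succ_le fun _ _ hv => hv.1

/-- Being finite or endangered passes to successors, since they reach no more than their
predecessor. Hence ranks do not increase along edges. -/
theorem notMem_dagSeq_succ_of_edge {w : ℕ → σ} {j : ℕ} {u v : Q × ℕ}
    (hu : u ∈ A.dagSeq w j) (hu' : u ∉ A.dagSeq w (j + 1))
    (hl : v.2 = u.2 + 1) (he : v.1 ∈ A.δ u.1 (w u.2)) : v ∉ A.dagSeq w (j + 1) := by
  intro hv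
  have hreach : ∀ x, A.Reach w (A.dagSeq w j) v x → A.Reach w (A.dagSeq w j) u x :=
    fun x hx => Relation.ReflTransGen.head ⟨hu, hv.1, hl, he⟩ hx
  refine hu' ⟨hu, fun hj hfin => hv.2.1 hj ⟨hv.1, hfin.2.subset hreach⟩,
    fun hj hend => hv.2.2 hj ⟨hv.1, fun x hx => hend.2 x (hreach x hx)⟩⟩

theorem mem_finiteVertices_of_even {w : ℕ → σ} {j : ℕ} {u : Q × ℕ} (hj : Even j)
    (hu : u ∈ A.dagSeq w j) (hu' : u ∉ A.dagSeq w (j + 1)) :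
    u ∈ A.finiteVertices w (A.dagSeq w j) := by
  by_contra h
  exact hu' ⟨hu, fun _ => h, fun ho => absurd hj (Nat.not_even_iff_odd.2 ho)⟩

theorem mem_endangeredVertices_of_odd {w : ℕ → σ} {j : ℕ} {u : Q × ℕ} (hj : Odd j)
    (hu : u ∈ A.dagSeq w j) (hu' : u ∉ A.dagSeq w (j + 1)) :
    u ∈ A.endangeredVertices w (A.dagSeq w j) := by
  by_contra h
  exact hu' ⟨hu, fun he => absurd hj (Nat.not_odd_iff_even.2 he), fun _ => h⟩

variable [Fintype Q]

theorem notMem_dagSeq_succ_of_vertexRank_le {w : ℕ → σ} {v : Q × ℕ} {j : ℕ}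
    (h : A.vertexRank w v ≤ j) : v ∉ A.dagSeq w (j + 1) := by
  intro hv
  have : ((j + 1 : ℕ) : ℕ∞) ≤ A.vertexRank w v := by
    refine le_iInf₂ fun i hi => ?_
    rw [Nat.cast_le]
    by_contra hlt
    exact hi.2 (A.dagSeq_antitone w (by omega) hv)
  have := this.trans h
  rw [Nat.cast_le] at this
  omega

theorem vertexRank_le_of_notMem {w : ℕ → σ} {v : Q × ℕ} {j : ℕ} (hj : j ≤ 2 * Fintype.card Q)
    (hv : v ∉ A.dagSeq w (j + 1)) : A.vertexRank w v ≤ j :=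
  iInf₂_le j ⟨hj, hv⟩

theorem mem_dagSeq_of_le_vertexRank {w : ℕ → σ} {v : Q × ℕ} {j : ℕ}
    (hj : j ≤ 2 * Fintype.card Q) (hv : v ∈ A.dag w) (h : j ≤ A.vertexRank w v) :
    v ∈ A.dagSeq w j := by
  cases j with
  | zero => exact hv
  | succ j =>
    by_contra hn
    have := h.trans (A.vertexRank_le_of_notMem (by omega) hn)
    rw [Nat.cast_le] at this
    omega

theorem consistent_of_levelRanking {w : ℕ → σ} {k : ℕ} {f f' : Q → ℕ}
    (hb : ∀ q, f q ≤ 2 * Fintype.card Q)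
    (hf : ∀ q, (f q : ℕ∞) = A.levelRanking w k q)
    (hf' : ∀ q, (f' q : ℕ∞) = A.levelRanking w (k + 1) q) :
    A.Consistent (A.level w k) (w k) f f' := by
  intro q hq
  have hr : (f q : ℕ∞) = A.vertexRank w (q, k) := by rw [hf, levelRanking, if_pos hq]
  have hmem : (q, k) ∈ A.dagSeq w (f q) := A.mem_dagSeq_of_le_vertexRank (hb q) hq hr.le
  have hnot : (q, k) ∉ A.dagSeq w (f q + 1) := A.notMem_dagSeq_succ_of_vertexRank_le hr.ge
  have hr' : ∀ q' ∈ A.δ q (w k), (f' q' : ℕ∞) = A.vertexRank w (q', k + 1) := fun q' hq' => by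
    rw [hf', levelRanking, if_pos ⟨q, hq, hq'⟩]
  have hle : ∀ q' ∈ A.δ q (w k), f' q' ≤ f q := by
    intro q' hq'
    rw [← Nat.cast_le (α := ℕ∞), hr' q' hq']
    exact A.vertexRank_le_of_notMem (hb q)
      (A.notMem_dagSeq_succ_of_edge (v := (q', k + 1)) hmem hnot rfl hq')
  refine ⟨hle, fun q' hq' => ?_⟩
  have hδ := A.δF_subset _ _ hq'
  rcases Nat.even_or_odd' (f q) with ⟨c, hc | hc⟩
  · have := hle q' hδ
    omega
  -- An endangered vertex has no accepting edge in its DAG, so the target of an accepting transition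
  -- was removed in an earlier step.
  · have hend := A.mem_endangeredVertices_of_odd ⟨c, hc⟩ hmem hnot
    have hn : (q', k + 1) ∉ A.dagSeq w (2 * c + 1) := fun hm =>
      (hend.2 _ Relation.ReflTransGen.refl).2 (q', k + 1) ⟨hmem, hc ▸ hm, rfl, hδ⟩ hq'
    have := A.vertexRank_le_of_notMem (by have := hb q; omega) hn
    rw [← hr' q' hδ, Nat.cast_le] at this
    omega

end RunDag

/-! ### Soundness: no word is accepted by both automata. -/

section Soundness

variable {σ Q : Type*} [Fintype Q] (A : BA σ Q)

theorem le_rankOf (f : Q → ℕ) (q : Q) : f q ≤ rankOf f :=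
  Finset.le_sup (Finset.mem_univ q)

theorem scheweWith_run_level {T : Set (Macrostate Q)} {w : ℕ → σ} {ρ : ℕ → Set Q ⊕ T}
    (h : (A.scheweWith T).IsRun w ρ) (k : ℕ) :
    Sum.elim id (fun m : T => m.1.S) (ρ k) = A.level w k := by
  induction k with
  | zero =>
    have : ρ 0 = Sum.inl A.I := h.1
    rw [this]
    rfl
  | succ k ih =>
    have hstep := h.2 k
    change _ = A.post (A.level w k) (w k)
    rw [← ih]
    cases hk : ρ k with
    | inl S =>
      rw [hk] at hstep
      rcases hstep with h1 | ⟨m, hm, h1⟩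
      · have h1 : ρ (k + 1) = Sum.inl (A.post S (w k)) := h1
        rw [h1]
        rfl
      · rw [h1]
        exact hm.1
    | inr m =>
      rw [hk] at hstep
      obtain ⟨m', hm, h1⟩ := hstep
      rw [h1]
      exact hm.1

/-- The tight part is never left. The values of `M` before `K` are arbitrary. -/
theorem scheweWith_tight_tail {T : Set (Macrostate Q)} {w : ℕ → σ} {ρ : ℕ → Set Q ⊕ T}
    (h : (A.scheweWith T).IsRun w ρ) {K : ℕ} {m : T} (hK : ρ K = Sum.inr m) :
    ∃ M : ℕ → Macrostate Q, (∀ k ≥ K, M k ∈ T) ∧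
      (∀ k ≥ K, ∀ m : T, ρ k = Sum.inr m → m.1 = M k) ∧
      (∀ k ≥ K, (M k).S = A.level w k) ∧ ∀ k ≥ K, A.TightStep (M k) (w k) (M (k + 1)) := by
  have hex : ∀ k ≥ K, ∃ m : T, ρ k = Sum.inr m := by
    intro k hk
    induction k, hk using Nat.le_induction with
    | base => exact ⟨m, hK⟩
    | succ k _ ih =>
      obtain ⟨m, hm⟩ := ih
      have hstep := h.2 k
      rw [hm] at hstep
      obtain ⟨m', -, h1⟩ := hstep
      exact ⟨m', h1⟩
  have hex' : ∀ k, ∃ m : T, K ≤ k → ρ k = Sum.inr m := fun k => by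
    by_cases hk : K ≤ k
    · obtain ⟨m, hm⟩ := hex k hk
      exact ⟨m, fun _ => hm⟩
    · exact ⟨m, fun h => absurd h hk⟩
  choose M hM using hex'
  refine ⟨fun k => (M k).1, fun k _ => (M k).2, fun k hk m hm => ?_, fun k hk => ?_,
    fun k hk => ?_⟩
  · rw [hM k hk] at hm
    exact congrArg Subtype.val (Sum.inr.inj hm).symm
  · have := A.scheweWith_run_level h k
    rwa [hM k hk] at this
  · have hstep := h.2 k
    rw [hM k hk, hM (k + 1) (by omega)] at hstep
    obtain ⟨m', h1, h2⟩ := hstep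
    obtain rfl := Sum.inr.inj h2
    exact h1

/-- An accepting run has eventually constant even rank in any consistent sequence of rankings. -/
theorem eventually_even_const_of_consistent {w : ℕ → σ} {ρ : ℕ → Q} (hρ : A.IsRun w ρ)
    (hacc : A.IsAccepting w ρ) {f : ℕ → Q → ℕ} {K : ℕ} (hr : ∀ k ≥ K, A.IsRanking (f k))
    (hc : ∀ k ≥ K, A.Consistent (A.level w k) (w k) (f k) (f (k + 1))) :
    ∃ c, Even c ∧ ∃ N ≥ K, ∀ k ≥ N, f k (ρ k) = c := by
  have hanti : Antitone fun k => f (K + k) (ρ (K + k)) := antitone_nat_of_succ_le fun k =>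
    (hc (K + k) (by omega) _ (hρ.mem_level _)).1 _ (hρ.2 _)
  obtain ⟨n, hn⟩ := Nat.sInf_mem (Set.range_nonempty fun k => f (K + k) (ρ (K + k)))
  have hconst : ∀ k ≥ K + n, f k (ρ k) = f (K + n) (ρ (K + n)) := by
    intro k hk
    obtain ⟨d, rfl⟩ := Nat.exists_eq_add_of_le (show K ≤ k by omega)
    exact (hanti (show n ≤ d by omega)).antisymm (hn.le.trans (Nat.sInf_le ⟨d, rfl⟩))
  refine ⟨_, ?_, K + n, by omega, hconst⟩
  rcases hacc with ⟨q, hq, hfr⟩ | ⟨p, a, q, hq, hfr⟩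
  · obtain ⟨k, hk, rfl⟩ := (frequently_atTop.1 hfr) (K + n)
    rw [← hconst k hk]
    exact (hr k (by omega)).2 _ hq
  · obtain ⟨k, hk, rfl, rfl, rfl⟩ := (frequently_atTop.1 hfr) (K + n)
    have := (hc k (by omega) _ (hρ.mem_level _)).2 _ hq
    -- With both ranks equal to `c`, consistency reads `c ≤ 2 * (c / 2)`.
    rw [hconst k hk, hconst (k + 1) (by omega)] at this
    rw [Nat.even_iff]
    omega

/-- Along a tight run with infinitely many breakpoints, every even index below the rank occurs
directly after a breakpoint. -/
theorem exists_breakpoint_index {w : ℕ → σ} {M : ℕ → Macrostate Q} {K r c : ℕ}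
    (hstep : ∀ k ≥ K, A.TightStep (M k) (w k) (M (k + 1)))
    (hev : ∀ k ≥ K, Even (M k).i) (hrank : ∀ k ≥ K, rankOf (M k).f = r) (hr : Odd r)
    (hO : ∀ N, ∃ k ≥ N, (M k).O = ∅) (hc : Even c) (hcr : c ≤ r) :
    ∃ k ≥ K, (M k).O = ∅ ∧ (M (k + 1)).i = c := by
  obtain ⟨k₀, hk₀, hO₀⟩ := hO K
  -- The index is frozen between breakpoints and advances by 2 modulo `r + 1` at each of them.
  have key : ∀ j, ∃ k ≥ K, (M k).O = ∅ ∧ (M (k + 1)).i = ((M (k₀ + 1)).i + 2 * j) % (r + 1) := by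
    intro j
    induction j with
    | zero =>
      refine ⟨k₀, hk₀, hO₀, ?_⟩
      have := ((hstep k₀ hk₀).2.2.2.1 hO₀).1
      rw [hrank _ (by omega)] at this
      rw [this]
      simp
    | succ j ih =>
      obtain ⟨k, hk, -, hi⟩ := ih
      classical
      have hex : ∃ d, (M (k + 1 + d)).O = ∅ := by
        obtain ⟨k', hk', h⟩ := hO (k + 1)
        exact ⟨k' - (k + 1), by rwa [Nat.add_sub_cancel' hk']⟩
      have hconst : ∀ d ≤ Nat.find hex, (M (k + 1 + d)).i = (M (k + 1)).i := by
        intro d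
        induction d with
        | zero => intro _; rfl
        | succ d ihd =>
          intro hd
          rw [← ihd (by omega)]
          exact ((hstep (k + 1 + d) (by omega)).2.2.2.2 (Nat.find_min hex hd)).1
      refine ⟨k + 1 + Nat.find hex, by omega, Nat.find_spec hex, ?_⟩
      have := ((hstep (k + 1 + Nat.find hex) (by omega)).2.2.2.1 (Nat.find_spec hex)).1
      rw [hrank _ (by omega), hconst _ le_rfl, hi, Nat.mod_add_mod] at this
      rw [this, mul_add, add_assoc]
  obtain ⟨a, ha⟩ := hev (k₀ + 1) (by omega)
  obtain ⟨b, rfl⟩ := hc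
  obtain ⟨m, rfl⟩ := hr
  -- Starting from `2a` with modulus `2m + 2`, this many advances add `2b + 2ma`, giving `2b + (2m +
  -- 2)a`, which is `2b` modulo `2m + 2`.
  obtain ⟨k, hk, h1, h2⟩ := key (b + m * a)
  refine ⟨k, hk, h1, ?_⟩
  rw [h2, ha, show a + a + 2 * (b + m * a) = (b + b) + (2 * m + 1 + 1) * a by ring,
    Nat.add_mul_mod_self_left, Nat.mod_eq_of_lt (by omega)]

theorem scheweWith_language_subset {T : Set (Macrostate Q)} (hT : T ⊆ A.tightPart) :
    (A.scheweWith T).language ⊆ A.languageᶜ := by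
  rintro w ⟨P, hP, hPacc⟩ ⟨ρ, hρ, hacc⟩
  rcases hPacc with ⟨s, hs, hfr⟩ | ⟨_, _, _, h, _⟩
  swap
  · exact h
  rcases hs with hs | ⟨m, hm, rfl⟩
  · have hs : s = Sum.inl ∅ := hs
    obtain ⟨k, hk⟩ := hfr.exists
    have := A.scheweWith_run_level hP k
    rw [hk, hs] at this
    have hmem := hρ.mem_level k
    rw [← this] at hmem
    exact hmem
  · obtain ⟨K, hK⟩ := hfr.exists
    obtain ⟨M, hMT, hM, hMS, hstep⟩ := A.scheweWith_tight_tail hP hK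
    have hO : ∀ N, ∃ k ≥ N, (M k).O = ∅ := by
      intro N
      obtain ⟨k, hk, hkm⟩ := frequently_atTop.1 hfr (max N K)
      exact ⟨k, le_of_max_le_left hk, by rw [← hM k (le_of_max_le_right hk) m hkm, hm]⟩
    have hcons : ∀ k ≥ K, A.Consistent (A.level w k) (w k) (M k).f (M (k + 1)).f :=
      fun k hk => hMS k hk ▸ (hstep k hk).2.1
    obtain ⟨c, hc, N, hN, hconst⟩ := A.eventually_even_const_of_consistent hρ hacc
      (fun k hk => (hT (hMT k hk)).1.1) hcons
    have hrank : ∀ k ≥ N, rankOf (M k).f = rankOf (M N).f := by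
      intro k hk
      induction k, hk using Nat.le_induction with
      | base => rfl
      | succ k hk ih => rw [← ih, (hstep k (by omega)).2.2.1]
    obtain ⟨k, hk, hkO, hki⟩ := A.exists_breakpoint_index (K := N)
      (fun k hk => hstep k (by omega)) (fun k hk => (hT (hMT k (by omega))).2.2.1) hrank
      (hT (hMT N hN)).1.2.1 hO hc (hconst N le_rfl ▸ le_rankOf _ _)
    -- After the breakpoint `O` is refilled with all states of rank `c`, including the run's; the
    -- run's successors keep rank `c` and so stay in `O`.
    have hin : ∀ l ≥ k + 1, ρ l ∈ (M l).O ∧ (M l).i = c := by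
      intro l hl
      induction l, hl using Nat.le_induction with
      | base =>
        refine ⟨?_, hki⟩
        rw [((hstep k (by omega)).2.2.2.1 hkO).2, hki, hMS _ (by omega)]
        exact ⟨hρ.mem_level _, hconst _ (by omega)⟩
      | succ l hl ih =>
        have := (hstep l (by omega)).2.2.2.2 (Set.nonempty_iff_ne_empty.1 ⟨_, ih.1⟩)
        rw [this.1, this.2, ih.2]
        exact ⟨⟨⟨ρ l, ih.1, hρ.2 l⟩, hconst _ (by omega)⟩, rfl⟩
    obtain ⟨l, hl, hlO⟩ := hO (k + 1)
    have := (hin l hl).1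
    rw [hlO] at this
    exact this

end Soundness

/-! ### Completeness: an accepting macrostate run for every rejected word. -/

section Completeness

variable {σ Q : Type*} [Fintype Q] (A : BA σ Q)

theorem mem_scheweWith_language_of_level_empty (T : Set (Macrostate Q)) {w : ℕ → σ} {k : ℕ}
    (h : A.level w k = ∅) : w ∈ (A.scheweWith T).language := by
  refine ⟨fun k => Sum.inl (A.level w k), ⟨rfl, fun k => Or.inl rfl⟩,
    Or.inl ⟨Sum.inl ∅, Or.inl rfl, ?_⟩⟩
  refine (eventually_atTop.2 ⟨k, fun m hm => ?_⟩).frequently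
  exact congrArg Sum.inl (A.level_eq_empty_of_le h hm)

open Classical in
/-- The deterministic breakpoint construction along the sequence of rankings `f`, started at
level `l`. -/
noncomputable def breakpointRun (w : ℕ → σ) (f : ℕ → Q → ℕ) (l : ℕ) : ℕ → Macrostate Q
  | 0 => ⟨A.level w l, ∅, f l, 0⟩
  | k + 1 =>
    let m := breakpointRun w f l k
    let S' := A.level w (l + (k + 1))
    let f' := f (l + (k + 1))
    if m.O = ∅ then
      let i' := (m.i + 2) % (rankOf f' + 1)
      ⟨S', S' ∩ {q | f' q = i'}, f', i'⟩
    else ⟨S', A.post m.O (w (l + k)) ∩ {q | f' q = m.i}, f', m.i⟩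

variable {A} {w : ℕ → σ} {f : ℕ → Q → ℕ} {l : ℕ}

theorem breakpointRun_S (k : ℕ) : (A.breakpointRun w f l k).S = A.level w (l + k) := by
  cases k with
  | zero => rfl
  | succ k => rw [breakpointRun]; split_ifs <;> rfl

theorem breakpointRun_f (k : ℕ) : (A.breakpointRun w f l k).f = f (l + k) := by
  cases k with
  | zero => rfl
  | succ k => rw [breakpointRun]; split_ifs <;> rfl

theorem breakpointRun_succ_of_eq {k : ℕ} (h : (A.breakpointRun w f l k).O = ∅) :
    (A.breakpointRun w f l (k + 1)).i =
      ((A.breakpointRun w f l k).i + 2) % (rankOf (f (l + (k + 1))) + 1) ∧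
    (A.breakpointRun w f l (k + 1)).O =
      A.level w (l + (k + 1)) ∩ {q | f (l + (k + 1)) q = (A.breakpointRun w f l (k + 1)).i} := by
  rw [breakpointRun, if_pos h]
  exact ⟨rfl, rfl⟩

theorem breakpointRun_succ_of_ne {k : ℕ} (h : (A.breakpointRun w f l k).O ≠ ∅) :
    (A.breakpointRun w f l (k + 1)).i = (A.breakpointRun w f l k).i ∧
    (A.breakpointRun w f l (k + 1)).O = A.post (A.breakpointRun w f l k).O (w (l + k)) ∩
      {q | f (l + (k + 1)) q = (A.breakpointRun w f l k).i} := by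
  rw [breakpointRun, if_neg h]
  exact ⟨rfl, rfl⟩

theorem breakpointRun_tightStep
    (hcons : ∀ k ≥ l, A.Consistent (A.level w k) (w k) (f k) (f (k + 1)))
    {r : ℕ} (hrank : ∀ k ≥ l, rankOf (f k) = r) (k : ℕ) :
    A.TightStep (A.breakpointRun w f l k) (w (l + k)) (A.breakpointRun w f l (k + 1)) := by
  refine ⟨?_, ?_, ?_, fun h => ?_, fun h => ?_⟩
  · rw [breakpointRun_S, breakpointRun_S]
    rfl
  · rw [breakpointRun_S, breakpointRun_f, breakpointRun_f]
    exact hcons _ (by omega)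
  · rw [breakpointRun_f, breakpointRun_f, hrank _ (by omega), hrank _ (by omega)]
  · rw [breakpointRun_f, breakpointRun_S]
    exact breakpointRun_succ_of_eq h
  · rw [breakpointRun_f]
    exact breakpointRun_succ_of_ne h

theorem breakpointRun_mem_tightPart (htight : ∀ k ≥ l, A.IsTight (A.level w k) (f k))
    {r : ℕ} (hrank : ∀ k ≥ l, rankOf (f k) = r) (k : ℕ) :
    A.breakpointRun w f l k ∈ A.tightPart := by
  have hodd : Odd r := hrank l le_rfl ▸ (htight l le_rfl).2.1
  have hr2 : r + 1 ≤ 2 * Fintype.card Q := by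
    have : r ≤ 2 * Fintype.card Q :=
      hrank l le_rfl ▸ Finset.sup_le fun q _ => (htight l le_rfl).1.1 q
    obtain ⟨c, rfl⟩ := hodd
    omega
  have hi : Even (A.breakpointRun w f l k).i ∧ (A.breakpointRun w f l k).i + 1 ≤ r ∧
      (A.breakpointRun w f l k).O ⊆
        A.level w (l + k) ∩ {q | f (l + k) q = (A.breakpointRun w f l k).i} := by
    obtain ⟨c, rfl⟩ := hodd
    induction k with
    | zero =>
      refine ⟨by simp [breakpointRun], ?_, by simp [breakpointRun]⟩
      simp [breakpointRun]
    | succ k ih =>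
      obtain ⟨he, hle, hsub⟩ := ih
      by_cases h : (A.breakpointRun w f l k).O = ∅
      · obtain ⟨h1, h2⟩ := breakpointRun_succ_of_eq h
        rw [hrank _ (by omega)] at h1
        -- Either the index does not wrap around or it wraps exactly to 0, so it stays even and
        -- below `r`.
        have hcase : (A.breakpointRun w f l k).i + 2 < 2 * c + 1 + 1 ∨
            (A.breakpointRun w f l k).i + 2 = 2 * c + 1 + 1 := by
          rw [Nat.even_iff] at he
          omega
        refine ⟨?_, ?_, h2.subset⟩ <;> rcases hcase with hlt | heq
        · rw [h1, Nat.mod_eq_of_lt hlt]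
          exact he.add even_two
        · simp [h1, heq]
        · rw [h1, Nat.mod_eq_of_lt hlt]
          rw [Nat.even_iff] at he
          omega
        · rw [h1, heq, Nat.mod_self]
          omega
      · obtain ⟨h1, h2⟩ := breakpointRun_succ_of_ne h
        rw [h1]
        refine ⟨he, hle, ?_⟩
        rw [h2]
        refine Set.inter_subset_inter_left _ ?_
        rintro q ⟨p, hp, hq⟩
        exact ⟨p, (hsub hp).1, hq⟩
  refine ⟨?_, ?_, hi.1, ?_⟩
  · rw [breakpointRun_S, breakpointRun_f]
    exact htight _ (by omega)
  · rw [breakpointRun_S, breakpointRun_f]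
    exact hi.2.2
  · omega

theorem breakpointRun_frequently_empty (htight : ∀ k ≥ l, A.IsTight (A.level w k) (f k))
    {r : ℕ} (hrank : ∀ k ≥ l, rankOf (f k) = r)
    (hf : ∀ k ≥ l, ∀ q, (f k q : ℕ∞) = A.levelRanking w k q) :
    ∃ᶠ k in atTop, (A.breakpointRun w f l k).O = ∅ := by
  rw [frequently_atTop]
  intro N
  by_contra! hne
  set M := A.breakpointRun w f l with hM
  set i := (M N).i with hi
  have hmem : ∀ k, M k ∈ A.tightPart := breakpointRun_mem_tightPart htight hrank
  have hconst : ∀ k ≥ N, (M k).i = i := by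
    intro k hk
    induction k, hk using Nat.le_induction with
    | base => rfl
    | succ k hk ih => rw [← ih, (breakpointRun_succ_of_ne (hne k hk).ne_empty).1]
  have hvert : ∀ k ≥ N, ∀ q ∈ (M k).O,
      (q, l + k) ∈ A.dagSeq w i ∧ (q, l + k) ∉ A.dagSeq w (i + 1) := by
    intro k hk q hq
    have h1 := (hmem k).2.1 hq
    have h2 : f (l + k) q = i := by
      rw [← hconst k hk, ← h1.2, breakpointRun_f]
    have h3 : q ∈ A.level w (l + k) := by
      rw [← breakpointRun_S (f := f)]
      exact h1.1
    have h4 : (i : ℕ∞) = A.vertexRank w (q, l + k) := by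
      rw [← h2, hf _ (by omega), levelRanking, if_pos h3]
    have h5 : i ≤ 2 * Fintype.card Q := by
      rw [← h2]
      exact (htight _ (by omega)).1.1 q
    exact ⟨A.mem_dagSeq_of_le_vertexRank h5 h3 h4.le,
      A.notMem_dagSeq_succ_of_vertexRank_le h4.ge⟩
  -- If `O` is never empty from `N` on, `i` is frozen and every later `O` lies in the part of the
  -- `i`-th DAG reachable from `O` at `N`. That part is finite, yet would contain vertices on
  -- arbitrarily high levels.
  set R : Set (Q × ℕ) :=
    ⋃ q ∈ (M N).O, {u | A.Reach w (A.dagSeq w i) (q, l + N) u} with hR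
  have hRfin : R.Finite := by
    refine (Set.toFinite (M N).O).biUnion fun q hq => ?_
    exact (A.mem_finiteVertices_of_even (hmem N).2.2.1 (hvert N le_rfl q hq).1
      (hvert N le_rfl q hq).2).2
  have hOR : ∀ k ≥ N, ∀ q ∈ (M k).O, (q, l + k) ∈ R := by
    intro k hk
    induction k, hk using Nat.le_induction with
    | base => exact fun q hq => Set.mem_biUnion hq Relation.ReflTransGen.refl
    | succ k hk ih =>
      intro q hq
      have hq' := hq
      rw [(breakpointRun_succ_of_ne (hne k hk).ne_empty).2] at hq'
      obtain ⟨⟨p, hp, hpq⟩, -⟩ := hq'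
      have := ih p hp
      rw [hR, Set.mem_iUnion₂] at this ⊢
      obtain ⟨s, hs, hsr⟩ := this
      exact ⟨s, hs, Relation.ReflTransGen.tail hsr
        ⟨(hvert k hk p hp).1, (hvert (k + 1) (by omega) q hq).1, rfl, hpq⟩⟩
  obtain ⟨B, hB⟩ := (hRfin.image Prod.snd).bddAbove
  obtain ⟨q, hq⟩ := hne (N + B + 1) (by omega)
  have := hB ⟨_, hOR (N + B + 1) (by omega) q hq, rfl⟩
  simp only at this
  omega

theorem mem_reducedSchewe_language_of_isTRUBWrt {μ : Set Q → Q → ℕ} (h : A.IsTRUBWrt μ w) :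
    w ∈ (A.reducedSchewe μ).language := by
  obtain ⟨l₀, ⟨r, hr⟩, hμ⟩ := h
  have hex : ∀ k, ∃ f : Q → ℕ, l₀ ≤ k →
      (∀ q, (f q : ℕ∞) = A.levelRanking w k q) ∧ A.IsTight Set.univ f ∧ rankOf f = r := by
    intro k
    by_cases hk : l₀ ≤ k
    · obtain ⟨f, hf⟩ := hr k hk
      exact ⟨f, fun _ => hf⟩
    · exact ⟨fun _ => 0, fun h => absurd h hk⟩
  choose f hf using hex
  have htight : ∀ k ≥ l₀, A.IsTight (A.level w k) (f k) := by
    intro k hk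
    obtain ⟨h1, ⟨h2, h3, h4, -⟩, -⟩ := hf k hk
    have hz : ∀ q, q ∉ A.level w k → f k q = 0 := by
      intro q hq
      have := h1 q
      rw [levelRanking, if_neg hq] at this
      exact_mod_cast this
    refine ⟨h2, h3, fun m hm hmr => ?_, hz⟩
    obtain ⟨q, -, hq⟩ := h4 m hm hmr
    -- States outside the level have rank 0, so odd values are attained inside it: `Q`-tightness
    -- gives tightness for the level.
    refine ⟨q, by_contra fun hn => ?_, hq⟩
    rw [hz q hn] at hq
    subst hq
    exact absurd hm (by decide)
  have hle : ∀ k ≥ l₀, f k ≤ μ (A.level w k) := by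
    intro k hk q
    rw [← Nat.cast_le (α := ℕ∞), (hf k hk).1 q]
    exact hμ k hk q
  have hrank : ∀ k ≥ l₀ + 1, rankOf (f k) = r := fun k hk => (hf k (by omega)).2.2
  have htight' : ∀ k ≥ l₀ + 1, A.IsTight (A.level w k) (f k) := fun k hk => htight k (by omega)
  have hcons : ∀ k ≥ l₀ + 1, A.Consistent (A.level w k) (w k) (f k) (f (k + 1)) := fun k hk =>
    A.consistent_of_levelRanking (htight k (by omega)).1.1 (hf k (by omega)).1
      (hf (k + 1) (by omega)).1
  have hT : ∀ k, A.breakpointRun w f (l₀ + 1) k ∈ A.reducedTightPart μ := by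
    refine fun k => ⟨breakpointRun_mem_tightPart htight' hrank k, ?_⟩
    rw [breakpointRun_f, breakpointRun_S]
    exact hle _ (by omega)
  -- The jump lands on level `l₀ + 1` because the initial state is waiting, even when `l₀ = 0`.
  let P : ℕ → Set Q ⊕ A.reducedTightPart μ := fun k =>
    if k ≤ l₀ then Sum.inl (A.level w k) else Sum.inr ⟨_, hT (k - (l₀ + 1))⟩
  have hPtight : ∀ k, P (l₀ + 1 + k) = Sum.inr ⟨_, hT k⟩ := by
    intro k
    simp only [P]
    rw [if_neg (by omega)]
    simp only [Nat.add_sub_cancel_left]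
  have hPwait : ∀ k ≤ l₀, P k = Sum.inl (A.level w k) := fun k hk => if_pos hk
  refine ⟨P, ⟨hPwait 0 (Nat.zero_le _), fun k => ?_⟩, Or.inl ?_⟩
  · rcases lt_trichotomy k l₀ with hk | rfl | hk
    · rw [hPwait k hk.le, hPwait (k + 1) hk]
      exact Or.inl rfl
    · rw [hPwait k le_rfl, hPtight 0]
      exact Or.inr ⟨_, ⟨rfl, rfl, htight' _ le_rfl, rfl⟩, rfl⟩
    · obtain ⟨d, rfl⟩ := Nat.exists_eq_add_of_le (show l₀ + 1 ≤ k from hk)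
      rw [hPtight d, add_assoc (l₀ + 1), hPtight (d + 1)]
      exact ⟨_, breakpointRun_tightStep hcons hrank d, rfl⟩
  · have hfr := breakpointRun_frequently_empty htight' hrank fun k hk => (hf k (by omega)).1
    have hfr' : ∃ᶠ k in atTop, ∃ q, q ∈ (A.reducedSchewe μ).F ∧ P k = q := by
      rw [frequently_atTop] at hfr ⊢
      intro N
      obtain ⟨k, hk, hO⟩ := hfr N
      exact ⟨l₀ + 1 + k, by omega, _, Or.inr ⟨⟨_, hT k⟩, hO, rfl⟩, hPtight k⟩
    -- Acceptance asks for one recurring state; with finitely many macrostates, the pigeonhole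
    -- principle provides it.
    by_contra! hno
    refine hfr' ?_
    have hall : ∀ᶠ k in atTop, ∀ q : Set Q ⊕ A.reducedTightPart μ,
        q ∈ (A.reducedSchewe μ).F → P k ≠ q := by
      rw [eventually_all]
      intro q
      by_cases hq : q ∈ (A.reducedSchewe μ).F
      · exact (hno q hq).mono fun k hk _ => hk
      · exact Eventually.of_forall fun k h => absurd h hq
    filter_upwards [hall] with k hk
    rintro ⟨q, hq, h⟩
    exact hk q hq h

theorem reducedSchewe_language {μ : Set Q → Q → ℕ} (hμ : A.IsTRUB μ) :
    (A.reducedSchewe μ).language = A.languageᶜ := by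
  refine (A.scheweWith_language_subset fun m hm => hm.1).antisymm fun w hw => ?_
  by_cases hrun : ∃ ρ, A.IsRun w ρ
  · exact mem_reducedSchewe_language_of_isTRUBWrt (hμ w hw hrun)
  · obtain ⟨k, hk⟩ : ∃ k, A.level w k = ∅ := by
      by_contra! h
      exact hrun (A.exists_isRun_of_level_nonempty w h)
    exact A.mem_scheweWith_language_of_level_empty _ hk

end Completeness

end BA

theorem mainTheorem4 {σ Q : Type*} [Finite σ] [Fintype Q] (A : BA σ Q) :
    (∀ μ : Set Q → Q → ℕ, A.IsTRUB μ → (A.reducedSchewe μ).language = A.languageᶜ) ∧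
    (∀ μ : Set Q → ℕ, A.IsTRUB (A.infunc μ) →
      (A.reducedSchewe (A.infunc μ)).language = A.languageᶜ) :=
  ⟨fun _ hμ => BA.reducedSchewe_language hμ, fun _ hμ => BA.reducedSchewe_language hμ⟩
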